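/- A word over the alphabet $\{0,1\}$ is called binary. A factor of a word is a contiguous subword. A word $w=w_1\cdots w_n$ has period $p\ge 1$ if $w_{i+p}=w_i$ for all $1\le i\le n-p$; the exponent of a nonempty word is its length divided by its least period. An extension of $w$ is a word $w'aw''$ with $w=w'w''$ ($w',w''$ possibly empty) and $a$ a letter of the alphabet. Let $\mathbb{R}_{\mathrm{ext}}$ be the totally ordered set consisting of all real numbers $x$ together with elements $x^+$, where $x^+$ covers $x$, i.e. $y\le x$ if and only if $y<x^+$ (so a real number $e$ satisfies $e\ge x^+$ if and only if $e>x$). For $\alpha,\beta\in\mathbb{R}_{\mathrm{ext}}$ with $1<\alpha\le\beta$, a word $w$ is $(\alpha,\beta)$-extremal if no factor of $w$ has exponent $\ge\alpha$, and every extension of $w$ contains a factor of exponent $\ge\beta$. **Proposition.** All of the following hold. (a) There are arbitrarily long $(2^+,7/3)$-extremal binary words. (b) There are arbitrarily long $(7/3^+,17/7)$-extremal binary words. (c) There are arbitrarily long $(17/7^+,5/2)$-extremal binary words. (d) There are arbitrarily long $(5/2^+,18/7)$-extremal binary words. (e) There are arbitrarily long $(18/7^+,8/3)$-extremal binary words.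 -/

import Mathlib

namespace BetaWords

/-- The extended real numbers `ℝ_ext`: every real `x` together with a new element `x⁺`, ordered
lexicographically, with `(x, false)` standing for `x` and `(x, true)` for `x⁺`. -/
abbrev RExt : Type := ℝ ×ₗ Bool

/-- The real number `x`, as an extended real number. -/
def RExt.ofReal (x : ℝ) : RExt := toLex (x, false)

/-- The extended real number `x⁺`. -/
def RExt.plus (x : ℝ) : RExt := toLex (x, true)

theorem RExt.ofReal_le_ofReal (x y : ℝ) : RExt.ofReal x ≤ RExt.ofReal y ↔ x ≤ y := by
  rw [RExt.ofReal, RExt.ofReal, Prod.Lex.toLex_le_toLex]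
  simp [← le_iff_lt_or_eq]

/-- `y ≤ x` and `y < x⁺` are equivalent for all `y ∈ ℝ_ext` and real `x`. -/
theorem RExt.lt_plus_iff (y : RExt) (x : ℝ) : y < RExt.plus x ↔ y ≤ RExt.ofReal x := by
  obtain ⟨a, b⟩ := y
  change toLex (a, b) < toLex (x, true) ↔ toLex (a, b) ≤ toLex (x, false)
  cases b <;> simp [Prod.Lex.toLex_le_toLex, Prod.Lex.toLex_lt_toLex]

/-- A real number is at least `b⁺` exactly when it is greater than `b`. -/
theorem RExt.plus_le_ofReal (b x : ℝ) : RExt.plus b ≤ RExt.ofReal x ↔ b < x := by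
  simp [RExt.ofReal, RExt.plus, Prod.Lex.toLex_le_toLex]

variable {A : Type*}

/-- The period of a word: the least `p ≥ 1` such that letters at distance `p` agree
(there always is one, as every `p ≥ |w|` qualifies). -/
noncomputable def period (w : List A) : ℕ := sInf {p : ℕ | 1 ≤ p ∧ w.HasPeriod p}

/-- The exponent of a word: its length divided by its period (`0` for the empty word). -/
noncomputable def exponent (w : List A) : ℝ := (w.length : ℝ) / (period w : ℝ)

/-- `w` contains a factor (contiguous subword) of exponent greater than or equal to `β`. -/
def HasFactorOfExponentGE (β : RExt) (w : List A) : Prop :=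
  ∃ u : List A, u <:+: w ∧ β ≤ RExt.ofReal (exponent u)

/-- `w` is `β`-free: no factor of `w` has exponent greater than or equal to `β`. -/
def IsFree (β : RExt) (w : List A) : Prop := ¬ HasFactorOfExponentGE β w

/-- `x` is an extension of `w`: it arises by inserting a single letter at some position
(possibly at either end) of `w`. -/
def IsExtension (w x : List A) : Prop :=
  ∃ (w₁ w₂ : List A) (a : A), w₁ ++ w₂ = w ∧ x = w₁ ++ a :: w₂

/-- `w` is `(α, β)`-extremal, where `1 < α ≤ β`: `w` is `α`-free, and every extension of `w`
contains a factor of exponent greater than or equal to `β`. -/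
def IsExtremal (α β : RExt) (w : List A) : Prop :=
  RExt.ofReal 1 < α ∧ α ≤ β ∧ IsFree α w ∧
    ∀ x : List A, IsExtension w x → HasFactorOfExponentGE β x

/-- There are arbitrarily long `(α, β)`-extremal words over the binary alphabet `{0, 1}`. -/
def ArbitrarilyLongExtremalBinary (α β : RExt) : Prop :=
  ∀ n : ℕ, ∃ w : List (Fin 2), n ≤ w.length ∧ IsExtremal α β w

end BetaWords

/-! Each of the five words families has the form P · H · S, where H is the image under a q-uniform
morphism h of the Thue-Morse word t on the positions [16 · 4^k X, 16 · 4^k Y). As t is fixed by μ :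
0 ↦ 01, 1 ↦ 10, H consists of the large blocks h(μ⁴(t_m)) with 4^k X ≤ m < 4^k Y. The letters of t
at 4^k X, 4^k X - 1, 4^k Y and 4^k Y - 1 do not depend on k, so neither do the two ends of the word.
Hence a short factor lies in `left`, in `right` or in a pair of consecutive blocks
(`Valid.window_cases`), and every local property is a finite computation.

Freeness (`Valid.not_periodicOn_word`): repetitions of period below P₀ are local. One of period p ≥
P₀ repeats its first and last l letters at distance p. Windows of length l meeting the irregular
letters at the two ends (the first c₁, the last c₂) occur only once, so the repetition lies in h(t).
Synchronization of h forces q ∣ p, and decoding yields an overlap in t, contradicting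
`tm_overlap_free`.

Extremality (`Valid.exists_periodicOn_insert`) is local: an inserted letter creates a power of small
period within N letters on each side, which is again checked on the ends and on pairs of blocks. -/

namespace BinaryWord

/-! ### Binary words encoded as natural numbers: letter `i` is bit `i` -/

/-- `f i` holds for all `i < n`. -/
def allBelow (n : ℕ) (f : ℕ → Bool) : Bool := Nat.rec true (fun k r => f k && r) n

/-- `f i` holds for some `i < n`. -/
def anyBelow (n : ℕ) (f : ℕ → Bool) : Bool := Nat.rec false (fun k r => f k || r) n

theorem allBelow_iff {n : ℕ} {f : ℕ → Bool} : allBelow n f = true ↔ ∀ i < n, f i = true := by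
  induction n with
  | zero => simp [allBelow]
  | succ n ih =>
    have h : allBelow (n + 1) f = (f n && allBelow n f) := rfl
    rw [h, Bool.and_eq_true, ih, Nat.forall_lt_succ_right]
    tauto

theorem anyBelow_iff {n : ℕ} {f : ℕ → Bool} : anyBelow n f = true ↔ ∃ i < n, f i = true := by
  induction n with
  | zero => simp [anyBelow]
  | succ n ih =>
    have h : anyBelow (n + 1) f = (f n || anyBelow n f) := rfl
    rw [h, Bool.or_eq_true, ih, Nat.exists_lt_succ_right, or_comm]

/-- Bit `i` tells whether letters `i` and `i + p` of `v` agree, for `i < n`. -/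
def agree (n v p : ℕ) : ℕ :=
  Nat.xor (Nat.sub (Nat.pow 2 n) 1) (Nat.xor v (Nat.shiftRight v p))

theorem agree_eq (n v p : ℕ) : agree n v p = (2 ^ n - 1) ^^^ (v ^^^ (v >>> p)) := rfl

theorem testBit_agree {n v p i : ℕ} (hi : i < n) :
    (agree n v p).testBit i = true ↔ v.testBit i = v.testBit (i + p) := by
  rw [agree_eq, Nat.testBit_xor, Nat.testBit_two_pow_sub_one, Nat.testBit_xor,
    Nat.testBit_shiftRight, Nat.add_comm p i]
  cases v.testBit i <;> cases v.testBit (i + p) <;> simp [hi]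

/-- Bit `i` tells whether bits `i, …, i + r` of `e` are all set. -/
def runs (e r : ℕ) : ℕ := 
  Nat.rec e (fun k y => Nat.land y (Nat.shiftRight e (Nat.succ k))) r

theorem testBit_runs {e r i : ℕ} :
    (runs e r).testBit i = true ↔ ∀ s ≤ r, e.testBit (i + s) = true := by
  induction r with
  | zero => simp [runs]
  | succ r ih =>
    have h : runs e (r + 1) = runs e r &&& (e >>> (r + 1)) := rfl
    rw [h, Nat.testBit_and, Bool.and_eq_true, ih, Nat.testBit_shiftRight, Nat.add_comm (r + 1) i]
    constructor
    · rintro ⟨h1, h2⟩ s hs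
      rcases Nat.le_succ_iff.mp hs with h | rfl
      · exact h1 s h
      · exact h2
    · exact fun h => ⟨fun s hs => h s (by omega), h _ le_rfl⟩

/-- The word `W` has the period `p` on the interval `[i, i + L)`. -/
def PeriodicOn (W : ℕ → Bool) (i L p : ℕ) : Prop := ∀ s, s + p < L → W (i + s) = W (i + s + p)

/-- The word `v` of length `n` has a factor of length `L` with period `p`. -/
def hasRep (n v p L : ℕ) : Bool :=
  Nat.ble L n && !(Nat.beq (Nat.mod (runs (agree n v p) (Nat.sub (Nat.sub L p) 1))
    (Nat.pow 2 (Nat.sub (Nat.succ n) L))) 0)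

theorem hasRep_eq (n v p L : ℕ) : hasRep n v p L = (Nat.ble L n &&
    !(Nat.beq (runs (agree n v p) (L - p - 1) % 2 ^ (n + 1 - L)) 0)) := rfl

/-- A repetition of length L and period p is a run of L - p agreements at distance p. Agreements
near the end of the word compare with bits beyond it; the reduction modulo 2 ^ (n + 1 - L) keeps
only the starts i ≤ n - L, whose runs stay inside the word. -/
theorem hasRep_iff {n v p L : ℕ} (hp : p < L) :
    hasRep n v p L = true ↔ ∃ i, i + L ≤ n ∧ PeriodicOn v.testBit i L p := by
  have key : ∀ i, i + L ≤ n →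
      ((runs (agree n v p) (L - p - 1)).testBit i = true ↔ PeriodicOn v.testBit i L p) := by
    intro i hi
    rw [testBit_runs]
    constructor
    · intro h s hs
      exact (testBit_agree (by omega)).mp (h s (by omega))
    · intro h s hs
      exact (testBit_agree (by omega)).mpr (h s (by omega))
  have hb : ∀ m : ℕ, (!(Nat.beq m 0)) = true ↔ m ≠ 0 := by
    intro m
    cases m <;> simp [Nat.beq]
  rw [hasRep_eq, Bool.and_eq_true, Nat.ble_eq, hb]
  constructor
  · rintro ⟨hL, h⟩
    obtain ⟨i, hi⟩ := Nat.exists_testBit_of_ne_zero h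
    rw [Nat.testBit_mod_two_pow, Bool.and_eq_true, decide_eq_true_eq] at hi
    exact ⟨i, by omega, (key i (by omega)).mp hi.2⟩
  · rintro ⟨i, hi, h⟩
    refine ⟨by omega, fun h0 => ?_⟩
    have h1 : (runs (agree n v p) (L - p - 1) % 2 ^ (n + 1 - L)).testBit i = true := by
      rw [Nat.testBit_mod_two_pow, Bool.and_eq_true, decide_eq_true_eq]
      exact ⟨by omega, (key i hi).mpr h⟩
    rw [h0] at h1
    simp at h1

/-- The word made of letters `i - a, …, i - 1` of `F`, the letter `c`, and letters
`i, …, i + b - 1` of `F`. -/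
def insertWindow (F i a b c : ℕ) : ℕ :=
  Nat.lor (Nat.mod (Nat.shiftRight F (Nat.sub i a)) (Nat.pow 2 a)) (Nat.lor (Nat.shiftLeft c a)
    (Nat.shiftLeft (Nat.mod (Nat.shiftRight F i) (Nat.pow 2 b)) (Nat.succ a)))

theorem insertWindow_eq (F i a b c : ℕ) : insertWindow F i a b c =
    (F >>> (i - a)) % 2 ^ a ||| (c <<< a ||| ((F >>> i) % 2 ^ b) <<< (a + 1)) := rfl

theorem testBit_insertWindow {F i a b : ℕ} {c : Bool} (ha : a ≤ i) {o : ℕ} (ho : o < a + 1 + b) :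
    (insertWindow F i a b c.toNat).testBit o =
      if o < a then F.testBit (i - a + o) else if o = a then c
      else F.testBit (i - a + o - 1) := by
  simp only [insertWindow_eq, Nat.testBit_or, Nat.testBit_mod_two_pow, Nat.testBit_shiftRight,
    Nat.testBit_shiftLeft]
  rcases lt_trichotomy o a with h | rfl | h
  · simp [h, show ¬ a ≤ o by omega, show ¬ a + 1 ≤ o by omega]
  · cases c <;> simp
  · rw [if_neg (by omega), if_neg (by omega)]
    have h1 : c.toNat.testBit (o - a) = false := by
      apply Nat.testBit_lt_two_pow
      exact lt_of_lt_of_le (Bool.toNat_lt c) (by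
        calc 2 = 2 ^ 1 := by norm_num
          _ ≤ _ := Nat.pow_le_pow_right (by norm_num) (by omega))
    rw [h1, show i + (o - (a + 1)) = i - a + o - 1 by omega]
    simp [show ¬ o < a by omega, show a + 1 ≤ o by omega, show o - (a + 1) < b by omega]

/-! ### The Thue-Morse word -/

/-- The parity of the number of ones among the `N` lowest binary digits of `n`. -/
def digitParity (N n : ℕ) : Bool := Nat.rec false (fun k r => Bool.xor r (n.testBit k)) N

/-- The Thue-Morse word. -/
def tm (n : ℕ) : Bool := digitParity n n

theorem digitParity_succ (N n : ℕ) :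
    digitParity (N + 1) n = Bool.xor (digitParity N n) (n.testBit N) := rfl

theorem digitParity_eq {N M n : ℕ} (h : n < 2 ^ N) (hM : N ≤ M) :
    digitParity M n = digitParity N n := by
  induction M, hM using Nat.le_induction with
  | base => rfl
  | succ M hM ih =>
    rw [digitParity_succ, ih, Nat.testBit_lt_two_pow (lt_of_lt_of_le h
      (Nat.pow_le_pow_right (by norm_num) hM)), Bool.xor_false]

theorem digitParity_succ' (N n : ℕ) :
    digitParity (N + 1) n = Bool.xor (n.testBit 0) (digitParity N (n / 2)) := by
  induction N with
  | zero => simp [digitParity]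
  | succ N ih =>
    rw [digitParity_succ, ih, digitParity_succ, Nat.testBit_succ, Bool.xor_assoc]

theorem tm_eq {N n : ℕ} (h : n < 2 ^ N) : tm n = digitParity N n := by
  rcases le_total n N with h' | h'
  · exact (digitParity_eq n.lt_two_pow_self h').symm
  · exact digitParity_eq h h'

theorem tm_two_mul_add (n : ℕ) (b : Bool) : tm (2 * n + b.toNat) = Bool.xor b (tm n) := by
  have hb := Bool.toNat_lt b
  have hn := n.lt_two_pow_self
  rw [tm_eq (N := n + 1) (by rw [pow_succ]; omega), digitParity_succ']
  congr 1
  · cases b <;> simp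
  · rw [show (2 * n + b.toNat) / 2 = n by omega, tm]

theorem tm_two_mul (n : ℕ) : tm (2 * n) = tm n := by simpa using tm_two_mul_add n false

theorem tm_two_mul_add_one (n : ℕ) : tm (2 * n + 1) = !tm n := by
  simpa using tm_two_mul_add n true

/-- With the next lemma, this makes the ends of the constructed words independent of k. -/
theorem tm_four_pow_mul (k n : ℕ) : tm (4 ^ k * n) = tm n := by
  induction k with
  | zero => simp
  | succ k ih =>
    rw [show 4 ^ (k + 1) * n = 2 * (2 * (4 ^ k * n)) by ring, tm_two_mul, tm_two_mul, ih]

/-- 4m - 1 is m - 1 with two binary digits 1 appended, which preserves the parity. Appending a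
single 1 would flip it, hence powers of 4 rather than of 2. -/
theorem tm_four_pow_mul_sub_one (k : ℕ) {n : ℕ} (hn : 1 ≤ n) :
    tm (4 ^ k * n - 1) = tm (n - 1) := by
  induction k with
  | zero => simp
  | succ k ih =>
    have h : 1 ≤ 4 ^ k * n := Nat.mul_pos (by positivity) hn
    have h4 : 4 ^ (k + 1) * n = 4 * (4 ^ k * n) := by ring
    rw [show 4 ^ (k + 1) * n - 1 = 2 * (2 * (4 ^ k * n - 1) + 1) + 1 by omega,
      tm_two_mul_add_one, tm_two_mul_add_one, Bool.not_not, ih]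

/-- The Thue-Morse word is overlap-free. -/
theorem tm_overlap_free (p : ℕ) (hp : 1 ≤ p) (i : ℕ) (h : ∀ j ≤ p, tm (i + j) = tm (i + j + p)) :
    False := by
  induction p using Nat.strong_induction_on generalizing i with
  | _ p ih =>
  have step : ∀ m, tm (2 * m) ≠ tm (2 * m + 1) := by
    intro m
    rw [tm_two_mul, tm_two_mul_add_one]
    simp
  rcases Nat.even_or_odd' p with ⟨r, rfl | rfl⟩
  -- An even period 2r: every second letter, starting at i, gives an overlap of period r.
  · refine ih r (by omega) (by omega) (i / 2) fun j hj => ?_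
    have h1 := h (2 * j) (by omega)
    rcases Nat.even_or_odd' i with ⟨n, rfl | rfl⟩
    · rw [show 2 * n + 2 * j = 2 * (n + j) by ring,
        show 2 * (n + j) + 2 * r = 2 * (n + j + r) by ring, tm_two_mul, tm_two_mul] at h1
      rwa [show 2 * n / 2 = n by omega]
    · rw [show 2 * n + 1 + 2 * j = 2 * (n + j) + 1 by ring,
        show 2 * (n + j) + 1 + 2 * r = 2 * (n + j + r) + 1 by ring, tm_two_mul_add_one,
        tm_two_mul_add_one, Bool.not_inj_iff] at h1
      rwa [show (2 * n + 1) / 2 = n by omega]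
  -- An odd period: equal neighbours cannot start at an even position, and shifting by the period
  -- changes the parity of the position. So the letters alternate, which contradicts equality at an
  -- odd distance.
  · have alt : ∀ j < 2 * r + 1, tm (i + j + 1) = !tm (i + j) := by
      intro j hj
      rw [Bool.eq_not_iff]
      intro he
      rcases Nat.even_or_odd' (i + j) with ⟨n, hn | hn⟩
      · apply step n
        rw [← hn, he]
      · apply step (n + r + 1)
        have h1 := h j (by omega)
        have h2 := h (j + 1) (by omega)
        rw [show i + j + (2 * r + 1) = 2 * (n + r + 1) by omega] at h1
        rw [show i + (j + 1) + (2 * r + 1) = 2 * (n + r + 1) + 1 by omega] at h2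
        rw [← h1, ← h2, ← he]
        rfl
    have par : ∀ j ≤ 2 * r + 1, tm (i + j) = Bool.xor (tm i) j.bodd := by
      intro j
      induction j with
      | zero => simp
      | succ j ihj =>
        intro hj
        rw [← Nat.add_assoc, alt j (by omega), ihj (by omega), Nat.bodd_succ]
        simp
    have h1 := h 0 (by omega)
    rw [Nat.add_zero, par (2 * r + 1) le_rfl] at h1
    revert h1
    simp

/-! ### The data of a construction and its finite checks -/

/-- The word `u` of length `s` followed by the word `v`. -/
def concat (u v s : ℕ) : ℕ := Nat.lor u (Nat.shiftLeft v s)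

/-- The data of a construction: the images `h₀, h₁` of the letters under a `q`-uniform morphism, a
range `[X, Y)` of positions in the Thue-Morse word, a prefix `P` and a suffix `S` of lengths `lp`,
`ls`, the numbers `c₁`, `c₂` of letters in the prefix and suffix that do not continue the morphic
word, and the sizes used in the finite checks: `l` and `N` are window lengths, `P₀` bounds the periods
that are checked individually, `pmax` bounds the periods of the powers created by insertions, and `K`
is the level of the blocks in which windows are looked up. Factors of exponent greater than `a / a'`
are to be avoided, and all insertions are to produce a factor of exponent at least `b / b'`. -/
structure Scheme where
  (a a' b b' q h₀ h₁ X Y lp P ls S c₁ c₂ l P₀ N pmax K : ℕ)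

namespace Scheme

variable (D : Scheme)

/-- The image of a letter under the morphism. -/
def img (c : Bool) : ℕ := cond c D.h₁ D.h₀

/-- The image of a letter under `h ∘ μ ^ j`, where `μ` is the Thue-Morse morphism. -/
def block (j : ℕ) : Bool → ℕ :=
  Nat.rec D.img (fun k f c => concat (f c) (f (!c)) (D.q * 2 ^ k)) j

/-- The length of the large blocks. -/
def Q : ℕ := D.q * 2 ^ 4

/-- The prefix and the first large block. -/
def left : ℕ := concat D.P (D.block 4 (tm D.X)) D.lp

/-- The last large block and the suffix. -/
def right : ℕ := concat (D.block 4 (tm (D.Y - 1))) D.S D.Q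

/-- Two consecutive blocks. -/
def pair (j : ℕ) (x y : Bool) : ℕ := concat (D.block j x) (D.block j y) (D.q * 2 ^ j)

/-- `f` holds for both letters. -/
def forBool (f : Bool → Bool) : Bool := f false && f true

/-- `f` holds for all pairs of blocks. -/
def forPairs (j : ℕ) (f : ℕ → ℕ → Bool) : Bool :=
  forBool fun x => forBool fun y => f (D.pair j x y) (2 * (D.q * 2 ^ j))

/-- The word `F` of length `n` has no repetition of period less than `P₀` and exponent greater than
`a / a'`. -/
def freeCheck (F n : ℕ) : Bool :=
  allBelow D.P₀ fun p => Nat.beq p 0 || !hasRep n F p (D.a * p / D.a' + 1)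

/-- `freeCheck` for all factors of length at most `Q` of the words constructed. -/
def freeCheckAll : Bool :=
  D.freeCheck D.left (D.lp + D.Q) && (D.freeCheck D.right (D.Q + D.ls) && D.forPairs 4 D.freeCheck)

/-- The word `v` of length `n` has a factor of exponent at least `b / b'`. -/
def hasPower (n v : ℕ) : Bool :=
  anyBelow D.pmax fun p => hasRep n v (p + 1) ((D.b * (p + 1) + D.b' - 1) / D.b')

/-- Both insertions at position `i` of `F` create a factor of exponent at least `b / b'` in the
window of the `x` letters before and the `y` letters after that position. -/
def insertCheck (F i x y : ℕ) : Bool := forBool fun c =>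
  D.hasPower (x + 1 + y) (insertWindow F i x y c.toNat)

/-- `insertCheck` at all positions with at least `N` letters on both sides. -/
def innerCheck (F n : ℕ) : Bool :=
  allBelow (n + 1 - 2 * D.N) fun i => D.insertCheck F (i + D.N) D.N D.N

/-- `insertCheck` near the left end. -/
def leftCheck : Bool :=
  allBelow (D.lp + D.N) fun i => D.insertCheck D.left i (min i D.N) D.N

/-- `insertCheck` near the right end. -/
def rightCheck : Bool :=
  allBelow (D.ls + D.N) fun i => D.insertCheck D.right (D.Q + D.ls - i) D.N (min i D.N)

/-- The factor of length `l` of `F` starting at position `i`. -/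
def window (F i : ℕ) : ℕ := Nat.mod (Nat.shiftRight F i) (Nat.pow 2 D.l)

theorem window_def (F i : ℕ) : D.window F i = (F >>> i) % 2 ^ D.l := rfl

/-- The word `v` of length `l` is not a factor of the word `F` of length `n`. -/
def notFactor (v F n : ℕ) : Bool := allBelow (n + 1 - D.l) fun i => !Nat.beq (D.window F i) v

/-- The windows of length `l` starting in the first `c₁` letters do not occur further right. -/
def leftUnique : Bool := allBelow D.c₁ fun i =>
  D.forPairs D.K (D.notFactor (D.window D.left i)) &&
    (D.notFactor (D.window D.left i) D.right (D.Q + D.ls) &&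
    allBelow (D.lp + D.Q - D.l - i) fun s =>
      !Nat.beq (D.window D.left (i + 1 + s)) (D.window D.left i))

/-- The windows of length `l` ending in the last `c₂` letters do not occur further left. -/
def rightUnique : Bool := allBelow D.c₂ fun i =>
  D.forPairs D.K (D.notFactor (D.window D.right (D.Q + D.ls - D.l - i))) &&
    (D.notFactor (D.window D.right (D.Q + D.ls - D.l - i)) D.left (D.lp + D.Q) &&
    allBelow (D.Q + D.ls - D.l - i) fun s =>
      !Nat.beq (D.window D.right s) (D.window D.right (D.Q + D.ls - D.l - i)))

/-- The image of a word of length two is not a factor of the image of a word of length three, except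
at multiples of `q`. -/
def syncCheck : Bool := forBool fun x => forBool fun y => forBool fun u => forBool fun v =>
  forBool fun w => allBelow (D.q - 1) fun δ =>
    !Nat.beq (Nat.mod (Nat.shiftRight (concat (D.img u) (concat (D.img v) (D.img w) D.q) D.q) (δ + 1))
      (Nat.pow 2 (2 * D.q))) (concat (D.img x) (D.img y) D.q)

/-- The numerical conditions and finite checks on the data. -/
structure Valid : Prop where
  a'_pos : 0 < D.a'
  b'_pos : 0 < D.b'
  two_le : 2 * D.a' ≤ D.a
  lt_b : D.a * D.b' < D.b * D.a'
  q_pos : 0 < D.q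
  h₀_lt : D.h₀ < 2 ^ D.q
  h₁_lt : D.h₁ < 2 ^ D.q
  h_ne : D.h₀ ≠ D.h₁
  P_lt : D.P < 2 ^ D.lp
  X_pos : 1 ≤ D.X
  X_lt_Y : D.X < D.Y
  c₁_le : D.c₁ ≤ D.lp
  lp_le : D.lp ≤ D.Q
  c₂_le : D.c₂ ≤ D.ls
  ls_le : D.ls ≤ D.Q
  l_le : D.l ≤ D.P₀
  l_le_Q : D.l ≤ D.Q
  l_le_K : D.l ≤ D.q * 2 ^ D.K
  P₀_pos : 1 ≤ D.P₀
  P₀_large : 3 * D.q ≤ D.P₀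
  -- Ensures that a repetition of period p ≥ P₀ and exponent above a / a' has length at least 2p +
  -- q.
  P₀_exp : D.a' * (2 * D.P₀ + D.q - 1) ≤ D.a * D.P₀
  -- The shortest forbidden repetitions of period below P₀ fit into one large block length.
  Q_large : D.a * (D.P₀ - 1) / D.a' + 1 ≤ D.Q
  N_le : 2 * D.N ≤ D.q * 2 ^ D.K
  N_le_Q : 2 * D.N ≤ D.Q
  -- Apart from its first c₁ letters, P is a suffix of the block that would precede it in h(t); the
  -- next field is the mirror statement for S.
  left_eq : D.P >>> D.c₁ = D.block 4 (tm (D.X - 1)) >>> (D.Q + D.c₁ - D.lp)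
  right_eq : D.S % 2 ^ (D.ls - D.c₂) = D.block 4 (tm D.Y) % 2 ^ (D.ls - D.c₂)
  free : D.freeCheckAll = true
  inner : D.forPairs D.K D.innerCheck = true
  insert_left : D.leftCheck = true
  insert_right : D.rightCheck = true
  unique_left : D.leftUnique = true
  unique_right : D.rightUnique = true
  sync : D.syncCheck = true

end Scheme

/-- Avoids exponents above `2`, produces exponents at least `7 / 3`. -/
def scheme₁ : Scheme :=
  ⟨2, 1, 7, 3, 1, 0x0, 0x1, 8, 10, 6, 0x24, 6, 0x36, 1, 1, 5, 5, 7, 4, 4⟩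

/-- Avoids exponents above `7 / 3`, produces exponents at least `17 / 7`. -/
def scheme₂ : Scheme :=
  ⟨7, 3, 17, 7, 26, 0x3659a64, 0x34d932c, 3, 4, 6, 0x33, 8, 0x6c, 3, 2, 14, 78, 16, 7, 1⟩

/-- Avoids exponents above `17 / 7`, produces exponents at least `5 / 2`. -/
def scheme₃ : Scheme :=
  ⟨17, 7, 5, 2, 19, 0x59b34, 0x64cb4, 3, 4, 14, 0x366c, 16, 0x366c, 11, 13, 17, 57, 17, 7, 1⟩

/-- Avoids exponents above `5 / 2`, produces exponents at least `18 / 7`. -/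
def scheme₄ : Scheme :=
  ⟨5, 2, 18, 7, 19, 0x59b34, 0x64cb4, 6, 7, 19, 0x5366c, 21, 0x6cd94, 16, 16, 17, 57, 17, 7, 1⟩

/-- Avoids exponents above `18 / 7`, produces exponents at least `8 / 3`. -/
def scheme₅ : Scheme :=
  ⟨18, 7, 8, 3, 17, 0x1364c, 0x166c9, 6, 7, 25, 0x13664c9, 14, 0x24c9, 14, 5, 19, 51, 18, 7, 2⟩

/-! ### Concatenation, periodicity on intervals, and the meaning of the checks -/

theorem testBit_concat {u v s : ℕ} (hu : u < 2 ^ s) (o : ℕ) :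
    (concat u v s).testBit o = if o < s then u.testBit o else v.testBit (o - s) := by
  have h : concat u v s = u ||| v <<< s := rfl
  rw [h, Nat.testBit_or, Nat.testBit_shiftLeft]
  split_ifs with ho
  · simp [show ¬ s ≤ o by omega]
  · rw [Nat.testBit_lt_two_pow (lt_of_lt_of_le hu (Nat.pow_le_pow_right (by norm_num) (by omega)))]
    simp [show s ≤ o by omega]

theorem concat_lt {u v s r : ℕ} (hu : u < 2 ^ s) (hv : v < 2 ^ r) :
    concat u v s < 2 ^ (s + r) := by
  refine Nat.or_lt_two_pow (lt_of_lt_of_le hu (Nat.pow_le_pow_right (by norm_num) (by omega))) ?_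
  change v <<< s < _
  rw [Nat.shiftLeft_eq, pow_add, mul_comm]
  exact Nat.mul_lt_mul_of_pos_left hv (by positivity)

theorem PeriodicOn.mono {W : ℕ → Bool} {i L p i' L' : ℕ} (h : PeriodicOn W i L p)
    (hi : i ≤ i') (hL : i' + L' ≤ i + L) : PeriodicOn W i' L' p := by
  intro s hs
  have := h (i' - i + s) (by omega)
  rwa [show i + (i' - i + s) = i' + s by omega] at this

theorem PeriodicOn.congr {W W' : ℕ → Bool} {i j L p : ℕ} (h : PeriodicOn W i L p)
    (he : ∀ o < L, W (i + o) = W' (j + o)) : PeriodicOn W' j L p := by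
  intro s hs
  rw [← he s (by omega), Nat.add_assoc, ← he (s + p) (by omega), ← Nat.add_assoc]
  exact h s hs

namespace Scheme

variable {D : Scheme}

theorem forBool_iff {f : Bool → Bool} : forBool f = true ↔ ∀ x, f x = true := by
  rw [forBool, Bool.and_eq_true, Bool.forall_bool]

theorem forPairs_iff {j : ℕ} {f : ℕ → ℕ → Bool} :
    D.forPairs j f = true ↔ ∀ x y, f (D.pair j x y) (2 * (D.q * 2 ^ j)) = true := by
  simp only [forPairs, forBool_iff]

theorem window_eq_iff {F i G j : ℕ} :
    Nat.beq (D.window F i) (D.window G j) = true ↔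
      ∀ o < D.l, F.testBit (i + o) = G.testBit (j + o) := by
  rw [Nat.beq_eq, window_def, window_def]
  constructor
  · intro h o ho
    have := congrArg (fun z => Nat.testBit z o) h
    simpa [Nat.testBit_mod_two_pow, Nat.testBit_shiftRight, ho] using this
  · intro h
    apply Nat.eq_of_testBit_eq
    intro o
    rw [Nat.testBit_mod_two_pow, Nat.testBit_mod_two_pow, Nat.testBit_shiftRight,
      Nat.testBit_shiftRight]
    by_cases ho : o < D.l
    · rw [h o ho]
    · simp [ho]

/-! ### The image of the Thue-Morse word -/

variable (D) in
/-- The image of the Thue-Morse word under the morphism. -/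
def morphic (i : ℕ) : Bool := (D.img (tm (i / D.q))).testBit (i % D.q)

theorem morphic_mul_add {m o : ℕ} (ho : o < D.q) :
    D.morphic (D.q * m + o) = (D.img (tm m)).testBit o := by
  rw [morphic, Nat.mul_add_div (by omega), Nat.div_eq_of_lt ho, Nat.add_zero,
    Nat.mul_add_mod, Nat.mod_eq_of_lt ho]

theorem Valid.img_lt (h : D.Valid) (c : Bool) : D.img c < 2 ^ D.q := by
  cases c
  · exact h.h₀_lt
  · exact h.h₁_lt

theorem block_succ (j : ℕ) (c : Bool) :
    D.block (j + 1) c = concat (D.block j c) (D.block j (!c)) (D.q * 2 ^ j) := rfl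

theorem Valid.block_lt (h : D.Valid) (j : ℕ) (c : Bool) : D.block j c < 2 ^ (D.q * 2 ^ j) := by
  induction j generalizing c with
  | zero => rw [pow_zero, mul_one]; exact h.img_lt c
  | succ j ih =>
    rw [block_succ, show D.q * 2 ^ (j + 1) = D.q * 2 ^ j + D.q * 2 ^ j by ring]
    exact concat_lt (ih _) (ih _)

/-- Induction on j: μ(t_m) = t_{2m} t_{2m+1}, so each block of level j + 1 is two consecutive blocks
of level j. -/
theorem Valid.testBit_block (h : D.Valid) {j m o : ℕ} (ho : o < D.q * 2 ^ j) :
    (D.block j (tm m)).testBit o = D.morphic (D.q * 2 ^ j * m + o) := by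
  induction j generalizing m o with
  | zero =>
    have ho' : o < D.q := by simpa using ho
    rw [pow_zero, mul_one, morphic_mul_add ho']
    rfl
  | succ j ih =>
    have e : D.q * 2 ^ (j + 1) = 2 * (D.q * 2 ^ j) := by ring
    rw [block_succ, testBit_concat (h.block_lt j _), e]
    split_ifs with hlt
    · rw [← tm_two_mul, ih hlt]
      congr 1
      ring
    · rw [← tm_two_mul_add_one, ih (by omega)]
      congr 1
      rw [mul_add, mul_one, ← mul_assoc, mul_comm (D.q * 2 ^ j) 2]
      omega

theorem Valid.testBit_pair (h : D.Valid) {j m o : ℕ} (ho : o < 2 * (D.q * 2 ^ j)) :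
    (D.pair j (tm m) (tm (m + 1))).testBit o = D.morphic (D.q * 2 ^ j * m + o) := by
  rw [pair, testBit_concat (h.block_lt j _)]
  split_ifs with hlt
  · exact h.testBit_block hlt
  · rw [h.testBit_block (by omega)]
    congr 1
    rw [mul_add, mul_one]
    omega

/-- Short factors of the morphic word are factors of the pairs of blocks. -/
theorem Valid.exists_pair (h : D.Valid) (j i len : ℕ) (hlen : len ≤ D.q * 2 ^ j) :
    ∃ x y s, s + len ≤ 2 * (D.q * 2 ^ j) ∧
      ∀ o < len, D.morphic (i + o) = (D.pair j x y).testBit (s + o) := by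
  have hq : 0 < D.q * 2 ^ j := Nat.mul_pos h.q_pos (by positivity)
  have hm := Nat.mod_lt i hq
  refine ⟨tm (i / (D.q * 2 ^ j)), tm (i / (D.q * 2 ^ j) + 1), i % (D.q * 2 ^ j), by omega, ?_⟩
  intro o ho
  rw [h.testBit_pair (by omega), ← Nat.add_assoc, Nat.div_add_mod]

/-- A position inside the block at which the two images differ: reading that one bit decodes the
letter. -/
theorem Valid.exists_img_ne (h : D.Valid) :
    ∃ ρ < D.q, ∀ x y, (D.img x).testBit ρ = (D.img y).testBit ρ → x = y := by
  obtain ⟨ρ, hρ⟩ := Nat.exists_testBit_ne_of_ne h.h_ne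
  refine ⟨ρ, ?_, ?_⟩
  · by_contra hge
    have hp := Nat.pow_le_pow_right (n := 2) (by norm_num) (not_lt.mp hge)
    exact hρ (by rw [Nat.testBit_lt_two_pow (h.h₀_lt.trans_le hp),
      Nat.testBit_lt_two_pow (h.h₁_lt.trans_le hp)])
  · rintro (_ | _) (_ | _) hxy
    · rfl
    · exact absurd hxy hρ
    · exact absurd hxy.symm hρ
    · rfl

/-- A long repetition in the morphic word comes from a repetition in the Thue-Morse word. -/
theorem Valid.dvd_of_periodicOn (h : D.Valid) {i L p : ℕ} (hp : 3 * D.q ≤ p) (hL : 2 * p ≤ L)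
    (hrep : PeriodicOn D.morphic i L p) : D.q ∣ p := by
  by_contra hdvd
  have hq := h.q_pos
  have hδ : 0 < p % D.q := Nat.pos_of_ne_zero fun h0 => hdvd (Nat.dvd_of_mod_eq_zero h0)
  have hδ' := Nat.mod_lt p hq
  -- The first block boundary in the repetition. The two blocks from there on recur p letters later,
  -- at offset p mod q within three blocks, which `syncCheck` forbids.
  obtain ⟨m, hm, hm'⟩ : ∃ m, i ≤ D.q * m ∧ D.q * m < i + D.q := by
    refine ⟨(i + (D.q - 1)) / D.q, ?_, ?_⟩
    · have := Nat.lt_mul_div_succ (i + (D.q - 1)) hq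
      rw [mul_add, mul_one] at this
      omega
    · have := Nat.mul_div_le (i + (D.q - 1)) D.q
      omega
  have hpe := Nat.div_add_mod p D.q
  set m' := m + p / D.q with hm'def
  have hmul : D.q * m' = D.q * m + D.q * (p / D.q) := by rw [hm'def, mul_add]
  have hs := h.sync
  simp only [syncCheck, forBool_iff, allBelow_iff] at hs
  have hs := hs (tm m) (tm (m + 1)) (tm m') (tm (m' + 1)) (tm (m' + 2)) (p % D.q - 1) (by omega)
  rw [Bool.not_eq_true', ← Bool.not_eq_true, Nat.beq_eq] at hs
  apply hs
  apply Nat.eq_of_testBit_eq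
  intro o
  change ((concat _ _ _ >>> _) % 2 ^ _).testBit o = _
  rw [Nat.testBit_mod_two_pow, Nat.testBit_shiftRight]
  have e1 : D.q * (m + 1) = D.q * m + D.q := by ring
  have e2 : D.q * (m' + 1) = D.q * m' + D.q := by ring
  have e3 : D.q * (m' + 2) = D.q * m' + 2 * D.q := by ring
  have two : ∀ o < 2 * D.q, (concat (D.img (tm m)) (D.img (tm (m + 1))) D.q).testBit o =
      D.morphic (D.q * m + o) := by
    intro o ho
    rw [testBit_concat (h.img_lt _)]
    split_ifs with hlt
    · rw [morphic_mul_add hlt]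
    · rw [← morphic_mul_add (by omega)]
      congr 1
      omega
  have three : ∀ o < 3 * D.q, (concat (D.img (tm m')) (concat (D.img (tm (m' + 1)))
      (D.img (tm (m' + 2))) D.q) D.q).testBit o = D.morphic (D.q * m' + o) := by
    intro o ho
    rw [testBit_concat (h.img_lt _)]
    split_ifs with hlt
    · rw [morphic_mul_add hlt]
    rw [testBit_concat (h.img_lt _)]
    split_ifs with hlt
    · rw [← morphic_mul_add (by omega)]
      congr 1
      omega
    · rw [← morphic_mul_add (by omega)]
      congr 1
      omega
  by_cases ho : o < 2 * D.q
  · rw [two o ho, three _ (by omega)]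
    have := hrep (D.q * m - i + o) (by omega)
    rw [show i + (D.q * m - i + o) = D.q * m + o by omega] at this
    simp only [ho, decide_true, Bool.true_and]
    rw [this]
    congr 1
    omega
  · have hlt : concat (D.img (tm m)) (D.img (tm (m + 1))) D.q < 2 ^ (D.q + D.q) :=
      concat_lt (h.img_lt _) (h.img_lt _)
    rw [Nat.testBit_lt_two_pow (hlt.trans_le (Nat.pow_le_pow_right (by norm_num) (by omega)))]
    simp [ho]

/-- Since p = qr, sampling the repetition at the decoding position of each block gives a repetition
of period r in t. The surplus of q letters over 2p guarantees the r + 1 agreements that form an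
overlap. -/
theorem Valid.not_periodicOn_morphic (h : D.Valid) {i L p : ℕ} (hp : 3 * D.q ≤ p)
    (hL : 2 * p + D.q ≤ L) : ¬ PeriodicOn D.morphic i L p := by
  intro hrep
  have hq := h.q_pos
  obtain ⟨r, rfl⟩ := h.dvd_of_periodicOn hp (by omega) hrep
  obtain ⟨ρ, hρ, hinj⟩ := h.exists_img_ne
  obtain ⟨m, hm, hm'⟩ : ∃ m, i ≤ D.q * m + ρ ∧ D.q * m + ρ < i + D.q := by
    rcases Nat.lt_or_ge (i + (D.q - 1)) ρ with hlt | hge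
    · omega
    refine ⟨(i + (D.q - 1) - ρ) / D.q, ?_, ?_⟩
    · have := Nat.lt_mul_div_succ (i + (D.q - 1) - ρ) hq
      rw [mul_add, mul_one] at this
      omega
    · have := Nat.mul_div_le (i + (D.q - 1) - ρ) D.q
      omega
  refine tm_overlap_free r ?_ m fun j hj => ?_
  · rcases Nat.eq_zero_or_pos r with rfl | hr
    · omega
    · exact hr
  · have hj' : D.q * j ≤ D.q * r := Nat.mul_le_mul_left _ hj
    have := hrep (D.q * m + ρ + D.q * j - i) (by omega)
    apply hinj
    rw [← morphic_mul_add hρ, ← morphic_mul_add hρ]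
    convert this using 2
    · rw [mul_add]; omega
    · rw [mul_add, mul_add]; omega

/-! ### The constructed words and their short factors -/

variable {D : Scheme}

variable (D) in
/-- The number of large blocks in the `k`-th word. -/
def M (k : ℕ) : ℕ := 4 ^ k * (D.Y - D.X)

variable (D) in
/-- The length of the `k`-th word. -/
def len (k : ℕ) : ℕ := D.lp + D.Q * D.M k + D.ls

variable (D) in
/-- The `k`-th word: the prefix, the large blocks with indices in `[4 ^ k * X, 4 ^ k * Y)` of the
morphic word, and the suffix. -/
def word (k i : ℕ) : Bool :=
  if i < D.lp then D.P.testBit i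
  else if i < D.lp + D.Q * D.M k then D.morphic (D.Q * (4 ^ k * D.X) + (i - D.lp))
  else D.S.testBit (i - (D.lp + D.Q * D.M k))

theorem Valid.M_pos (h : D.Valid) (k : ℕ) : 1 ≤ D.M k :=
  Nat.mul_pos (by positivity) (Nat.sub_pos_of_lt h.X_lt_Y)

theorem Valid.Q_mul_M_eq (h : D.Valid) (k : ℕ) : D.Q * D.M k = D.Q * (D.M k - 1) + D.Q := by
  have hM := h.M_pos k
  conv_lhs => rw [show D.M k = (D.M k - 1) + 1 by omega, mul_add, mul_one]

theorem Valid.Q_le (h : D.Valid) (k : ℕ) : D.Q ≤ D.Q * D.M k :=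
  Nat.le_mul_of_pos_right _ (h.M_pos k)

theorem Valid.Q_mul_M (h : D.Valid) (k : ℕ) :
    D.Q * (4 ^ k * D.X) + D.Q * D.M k = D.Q * (4 ^ k * D.Y) := by
  rw [M, ← mul_add, ← mul_add, Nat.add_sub_cancel' h.X_lt_Y.le]

theorem Valid.word_left (h : D.Valid) (k : ℕ) {i : ℕ} (hi : i < D.lp + D.Q) :
    D.word k i = D.left.testBit i := by
  have hQ := h.Q_le k
  rw [word, left, testBit_concat h.P_lt]
  split_ifs with h1 h2
  · rfl
  · rw [← tm_four_pow_mul k, h.testBit_block (by unfold Q at *; omega), Q]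
  · omega

theorem Valid.word_right (h : D.Valid) (k i : ℕ) :
    D.word k (D.lp + D.Q * (D.M k - 1) + i) = D.right.testBit i := by
  have e := h.Q_mul_M_eq k
  have hs := h.Q_mul_M k
  rw [word, right, testBit_concat (s := D.Q) (h.block_lt 4 _), if_neg (by omega)]
  by_cases h1 : i < D.Q
  · have hY : 1 ≤ D.Y := h.X_pos.trans h.X_lt_Y.le
    rw [if_pos (by omega), if_pos h1, ← tm_four_pow_mul_sub_one k hY, h.testBit_block h1]
    congr 1
    have h4 : 1 ≤ 4 ^ k * D.Y := Nat.mul_pos (by positivity) hY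
    have e2 : D.Q * (4 ^ k * D.Y) = D.Q * (4 ^ k * D.Y - 1) + D.Q := by
      conv_lhs => rw [show 4 ^ k * D.Y = (4 ^ k * D.Y - 1) + 1 by omega, mul_add, mul_one]
    change _ = D.Q * _ + i
    omega
  · rw [if_neg (by omega), if_neg h1]
    congr 1
    omega

/-- The word continues the morphic word, except near its ends. -/
theorem Valid.word_morphic (h : D.Valid) (k : ℕ) {i : ℕ} (hi : D.c₁ ≤ i)
    (hi' : i + D.c₂ < D.len k) :
    D.word k i = D.morphic (D.Q * (4 ^ k * D.X) - D.lp + i) := by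
  have hX : 1 ≤ 4 ^ k * D.X := Nat.mul_pos (by positivity) h.X_pos
  have hQX : D.Q * (4 ^ k * D.X) = D.Q * (4 ^ k * D.X - 1) + D.Q := by
    conv_lhs => rw [show 4 ^ k * D.X = (4 ^ k * D.X - 1) + 1 by omega, mul_add, mul_one]
  have hlp := h.lp_le
  have hls := h.ls_le
  have hc₁ := h.c₁_le
  have hc₂ := h.c₂_le
  have hs := h.Q_mul_M k
  rw [len] at hi'
  rw [word]
  split_ifs with h1 h2
  -- Inside P: `left_eq` refers to the letter of t at X - 1, which equals the one at 4^k X - 1.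
  · have e1 := congrArg (fun z => Nat.testBit z (i - D.c₁)) h.left_eq
    simp only [Nat.testBit_shiftRight] at e1
    rw [← tm_four_pow_mul_sub_one k h.X_pos, h.testBit_block (by unfold Q at *; omega)] at e1
    rw [show D.c₁ + (i - D.c₁) = i by omega] at e1
    rw [e1]
    change D.morphic (D.Q * _ + _) = _
    congr 1
    omega
  · congr 1
    omega
  · have e1 := congrArg (fun z => Nat.testBit z (i - (D.lp + D.Q * D.M k))) h.right_eq
    have hlt : i - (D.lp + D.Q * D.M k) < D.ls - D.c₂ := by omega
    simp only [Nat.testBit_mod_two_pow, hlt, decide_true, Bool.true_and] at e1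
    rw [← tm_four_pow_mul k, h.testBit_block (by unfold Q at *; omega)] at e1
    rw [e1]
    change D.morphic (D.Q * _ + _) = _
    congr 1
    omega

/-- A short factor of the word is a factor of `left`, of `right`, or of a pair of blocks. -/
theorem Valid.window_cases (h : D.Valid) (k : ℕ) {i r : ℕ} (j : ℕ) (hrQ : r ≤ D.Q)
    (hr : r ≤ D.q * 2 ^ j) :
    i + r ≤ D.lp + D.Q ∨ D.lp + D.Q * (D.M k - 1) ≤ i ∨
      ∃ x y s, s + r ≤ 2 * (D.q * 2 ^ j) ∧
        ∀ o < r, D.word k (i + o) = (D.pair j x y).testBit (s + o) := by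
  rcases Nat.lt_or_ge (D.lp + D.Q) (i + r) with h1 | h1
  swap
  · exact Or.inl h1
  rcases Nat.lt_or_ge i (D.lp + D.Q * (D.M k - 1)) with h2 | h2
  swap
  · exact Or.inr (Or.inl h2)
  right; right
  -- As r ≤ Q, a window reaching beyond `left` and starting before `right` lies entirely in the
  -- large blocks.
  have e := h.Q_mul_M_eq k
  obtain ⟨x, y, s, hs, heq⟩ := h.exists_pair j (D.Q * (4 ^ k * D.X) + (i - D.lp)) r hr
  refine ⟨x, y, s, hs, fun o ho => ?_⟩
  rw [← heq o ho, word, if_neg (by omega), if_pos (by omega)]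
  congr 1
  omega

theorem notFactor_false {F G n i s : ℕ} (h : D.notFactor (D.window G i) F n = true)
    (hs : s + D.l ≤ n) (heq : ∀ o < D.l, F.testBit (s + o) = G.testBit (i + o)) : False := by
  rw [notFactor, allBelow_iff] at h
  have := h s (by omega)
  rw [Bool.not_eq_true', ← Bool.not_eq_true, window_eq_iff] at this
  exact this heq

/-- This keeps long repetitions away from the irregular first c₁ letters. A second occurrence would
lie in `left`, in `right` or in a pair of blocks; `leftUnique` excludes all three. -/
theorem Valid.not_eq_left (h : D.Valid) (k : ℕ) {i j : ℕ} (hi : i < D.c₁) (hij : i < j)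
    (hj : j + D.l ≤ D.len k) : ¬ ∀ o < D.l, D.word k (i + o) = D.word k (j + o) := by
  intro heq
  have hc := h.c₁_le
  have hl := h.l_le_Q
  have hQ := h.Q_le k
  have e := h.Q_mul_M_eq k
  have hu := h.unique_left
  rw [leftUnique, allBelow_iff] at hu
  have hu := hu i hi
  rw [Bool.and_eq_true, Bool.and_eq_true, forPairs_iff, allBelow_iff] at hu
  obtain ⟨hu1, hu2, hu3⟩ := hu
  have hleft : ∀ o < D.l, D.word k (i + o) = D.left.testBit (i + o) := fun o ho =>
    h.word_left k (by omega)
  rcases h.window_cases k (i := j) (r := D.l) D.K hl h.l_le_K with h1 | h1 | ⟨x, y, s, hs, h1⟩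
  · have := hu3 (j - i - 1) (by omega)
    rw [Bool.not_eq_true', ← Bool.not_eq_true, window_eq_iff] at this
    refine this fun o ho => ?_
    rw [← hleft o ho, heq o ho, h.word_left k (by omega)]
    congr 1
    omega
  · rw [len] at hj
    refine notFactor_false hu2 (s := j - (D.lp + D.Q * (D.M k - 1))) (by omega) fun o ho => ?_
    rw [← hleft o ho, heq o ho, ← h.word_right k]
    congr 1
    omega
  · exact notFactor_false (hu1 x y) hs fun o ho => by rw [← hleft o ho, heq o ho, h1 o ho]

theorem Valid.not_eq_right (h : D.Valid) (k : ℕ) {i j : ℕ} (hi : D.len k < i + D.l + D.c₂)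
    (hi' : i + D.l ≤ D.len k) (hj : j < i) :
    ¬ ∀ o < D.l, D.word k (i + o) = D.word k (j + o) := by
  intro heq
  have hc := h.c₂_le
  have hl := h.l_le_Q
  have hQ := h.Q_le k
  have e := h.Q_mul_M_eq k
  rw [len] at hi hi'
  have hu := h.unique_right
  rw [rightUnique, allBelow_iff] at hu
  have hu := hu (D.lp + D.Q * D.M k + D.ls - (i + D.l)) (by omega)
  rw [show D.Q + D.ls - D.l - (D.lp + D.Q * D.M k + D.ls - (i + D.l)) =
    i - (D.lp + D.Q * (D.M k - 1)) by omega] at hu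
  rw [Bool.and_eq_true, Bool.and_eq_true, forPairs_iff, allBelow_iff] at hu
  obtain ⟨hu1, hu2, hu3⟩ := hu
  have hright : ∀ o < D.l, D.word k (i + o) =
      D.right.testBit (i - (D.lp + D.Q * (D.M k - 1)) + o) := fun o ho => by
    rw [← h.word_right k]
    congr 1
    omega
  rcases h.window_cases k (i := j) (r := D.l) D.K hl h.l_le_K with h1 | h1 | ⟨x, y, s, hs, h1⟩
  · exact notFactor_false hu2 h1 fun o ho => by
      rw [← hright o ho, heq o ho, h.word_left k (by omega)]
  · have := hu3 (j - (D.lp + D.Q * (D.M k - 1))) (by omega)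
    rw [Bool.not_eq_true', ← Bool.not_eq_true, window_eq_iff] at this
    refine this fun o ho => ?_
    rw [← hright o ho, heq o ho, ← h.word_right k]
    congr 1
    omega
  · exact notFactor_false (hu1 x y) hs fun o ho => by rw [← hright o ho, heq o ho, h1 o ho]

/-! ### Absence of large exponents -/

theorem freeCheck_not_periodicOn {F n i p : ℕ} (h : D.freeCheck F n = true) (hp : 1 ≤ p)
    (hpP : p < D.P₀) (hlt : p < D.a * p / D.a' + 1) (hi : i + (D.a * p / D.a' + 1) ≤ n) :
    ¬ PeriodicOn F.testBit i (D.a * p / D.a' + 1) p := by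
  intro hrep
  rw [freeCheck, allBelow_iff] at h
  have := h p hpP
  rw [Bool.or_eq_true, Nat.beq_eq, Bool.not_eq_true', ← Bool.not_eq_true, hasRep_iff hlt] at this
  rcases this with h0 | h0
  · omega
  · exact h0 ⟨i, hi, hrep⟩

/-- The words have no factors of exponent greater than `a / a'`. -/
theorem Valid.not_periodicOn_word (h : D.Valid) (k : ℕ) {i L p : ℕ} (hp : 1 ≤ p)
    (hi : i + L ≤ D.len k) (hL : D.a * p < D.a' * L) : ¬ PeriodicOn (D.word k) i L p := by
  intro hrep
  have ha' := h.a'_pos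
  have hL' : D.a * p / D.a' + 1 ≤ L := by
    rw [Nat.succ_le_iff, Nat.div_lt_iff_lt_mul ha', mul_comm L]
    exact hL
  have h2 : 2 * p ≤ D.a * p / D.a' := by
    rw [Nat.le_div_iff_mul_le ha']
    calc 2 * p * D.a' = 2 * D.a' * p := by ring
      _ ≤ D.a * p := Nat.mul_le_mul_right _ h.two_le
  rcases Nat.lt_or_ge p D.P₀ with hpP | hpP
  · have hQ : D.a * p / D.a' + 1 ≤ D.Q := by
      refine le_trans ?_ h.Q_large
      gcongr
      omega
    -- It suffices to exclude the shortest forbidden length, which is at most Q.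
    have hrep' : PeriodicOn (D.word k) i (D.a * p / D.a' + 1) p := hrep.mono le_rfl (by omega)
    have hf := h.free
    rw [freeCheckAll, Bool.and_eq_true, Bool.and_eq_true, forPairs_iff] at hf
    obtain ⟨hf1, hf2, hf3⟩ := hf
    rcases h.window_cases k (i := i) 4 hQ hQ with h1 | h1 | ⟨x, y, s, hs, h1⟩
    · exact freeCheck_not_periodicOn hf1 hp hpP (by omega) h1
        (hrep'.congr fun o ho => h.word_left k (by omega))
    · have e := h.Q_mul_M_eq k
      rw [len] at hi
      refine freeCheck_not_periodicOn (i := i - (D.lp + D.Q * (D.M k - 1))) hf2 hp hpP (by omega)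
        (by omega) (hrep'.congr fun o ho => ?_)
      rw [← h.word_right k]
      congr 1
      omega
    · exact freeCheck_not_periodicOn (hf3 x y) hp hpP (by omega) hs (hrep'.congr h1)
  · have hlP := h.l_le
    have hLp : 2 * p + D.q ≤ L := by
      have h3 : 2 * p + D.q - 1 ≤ D.a * p / D.a' := by
        rw [Nat.le_div_iff_mul_le ha']
        obtain ⟨r, rfl⟩ := Nat.exists_eq_add_of_le hpP
        have h4 := h.P₀_exp
        have h5 : 2 * D.a' * r ≤ D.a * r := Nat.mul_le_mul_right _ h.two_le
        have h6 : 2 * (D.P₀ + r) + D.q - 1 = (2 * D.P₀ + D.q - 1) + 2 * r := by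
          have := h.P₀_pos
          omega
        rw [h6]
        nlinarith
      have := h.q_pos
      omega
    -- The first l letters recur p later, and p + l ≤ 2p ≤ L because l ≤ P₀ ≤ p.
    have hleft : D.c₁ ≤ i := by
      by_contra hlt
      refine h.not_eq_left k (i := i) (j := i + p) (by omega) (by omega) (by omega) fun o ho => ?_
      rw [hrep o (by omega)]
      congr 1
      omega
    have hright : i + L + D.c₂ ≤ D.len k := by
      by_contra hlt
      refine h.not_eq_right k (i := i + L - D.l) (j := i + L - D.l - p) (by omega) (by omega)
        (by omega) fun o ho => ?_
      have := hrep (L - D.l - p + o) (by omega)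
      rw [show i + L - D.l + o = i + (L - D.l - p + o) + p by omega, ← this]
      congr 1
      omega
    have hP := h.P₀_large
    refine h.not_periodicOn_morphic (i := D.Q * (4 ^ k * D.X) - D.lp + i) (L := L) (p := p)
      (by omega) hLp (hrep.congr fun o ho => ?_)
    rw [h.word_morphic k (by omega) (by omega)]
    congr 1
    omega

/-! ### Insertions -/

/-- The word `W` with the letter `c` inserted at position `j`. -/
def insert (W : ℕ → Bool) (j : ℕ) (c : Bool) (i : ℕ) : Bool :=
  if i < j then W i else if i = j then c else W (i - 1)

/-- Transfers a check on a window of F to any word that agrees with F around the insertion point. -/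
theorem insertCheck_periodicOn (hb : D.b' < D.b) (hb' : 0 < D.b') {W : ℕ → Bool}
    {F i x y j : ℕ} (h : D.insertCheck F i x y = true) (hx : x ≤ i) (hxj : x ≤ j)
    (heq : ∀ o < x + y, W (j - x + o) = F.testBit (i - x + o)) (c : Bool) :
    ∃ s L p, 1 ≤ p ∧ s + L ≤ j + y + 1 ∧ D.b * p ≤ D.b' * L ∧ PeriodicOn (insert W j c) s L p := by
  rw [insertCheck, forBool_iff] at h
  have h := h c
  rw [hasPower, anyBelow_iff] at h
  obtain ⟨p, -, h⟩ := h
  -- The length tested by `hasPower` is the ceiling of b(p + 1) / b'; as b' < b, it exceeds the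
  -- period p + 1.
  have hL : D.b * (p + 1) ≤ D.b' * ((D.b * (p + 1) + D.b' - 1) / D.b') := by
    generalize D.b * (p + 1) = T
    have := Nat.lt_mul_div_succ (T + D.b' - 1) hb'
    rw [Nat.mul_succ] at this
    omega
  have hpL : p + 1 < (D.b * (p + 1) + D.b' - 1) / D.b' := by
    by_contra hge
    have h1 := Nat.mul_le_mul_left D.b' (not_lt.mp hge)
    have h2 : D.b' * (p + 1) < D.b * (p + 1) := Nat.mul_lt_mul_of_pos_right hb (by omega)
    omega
  rw [hasRep_iff hpL] at h
  obtain ⟨s, hs, hrep⟩ := h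
  refine ⟨j - x + s, _, p + 1, by omega, by omega, hL, hrep.congr fun o ho => ?_⟩
  rw [testBit_insertWindow hx (by omega), insert]
  by_cases h1 : s + o < x
  · rw [if_pos h1, if_pos (by omega), Nat.add_assoc, heq _ (by omega)]
  · by_cases h2 : s + o = x
    · rw [if_neg h1, if_pos h2, if_neg (by omega), if_pos (by omega)]
    · rw [if_neg h1, if_neg h2, if_neg (by omega), if_neg (by omega)]
      have := heq (s + o - 1) (by omega)
      rw [show j - x + s + o - 1 = j - x + (s + o - 1) by omega, this]
      congr 1
      omega

/-- All insertions into the words create a factor of exponent at least `b / b'`. -/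
theorem Valid.exists_periodicOn_insert (h : D.Valid) (k : ℕ) {j : ℕ} (hj : j ≤ D.len k) (c : Bool) :
    ∃ s L p, 1 ≤ p ∧ s + L ≤ D.len k + 1 ∧ D.b * p ≤ D.b' * L ∧
      PeriodicOn (insert (D.word k) j c) s L p := by
  have hb' := h.b'_pos
  have hb : D.b' < D.b := by
    by_contra hge
    have h1 := Nat.mul_le_mul (not_lt.mp hge) (le_refl D.a')
    have h2 := Nat.mul_le_mul_right D.b' h.two_le
    have h3 := h.lt_b
    nlinarith [Nat.mul_pos hb' h.a'_pos]
  have hQ := h.Q_le k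
  have hN := h.N_le_Q
  have e := h.Q_mul_M_eq k
  have hlen : D.len k = D.lp + D.Q * D.M k + D.ls := rfl
  have weaken : ∀ {y}, j + y ≤ D.len k → (∃ s L p, 1 ≤ p ∧ s + L ≤ j + y + 1 ∧
      D.b * p ≤ D.b' * L ∧ PeriodicOn (insert (D.word k) j c) s L p) →
      ∃ s L p, 1 ≤ p ∧ s + L ≤ D.len k + 1 ∧ D.b * p ≤ D.b' * L ∧
      PeriodicOn (insert (D.word k) j c) s L p := by
    rintro y hy ⟨s, L, p, h1, h2, h3⟩
    exact ⟨s, L, p, h1, by omega, h3⟩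
  rcases Nat.lt_or_ge j (D.lp + D.N) with h1 | h1
  · have hc := h.insert_left
    rw [leftCheck, allBelow_iff] at hc
    refine weaken (by omega) (insertCheck_periodicOn hb hb' (hc j h1) (min_le_left _ _)
      (min_le_left _ _) (fun o ho => ?_) c)
    exact h.word_left k (by omega)
  rcases Nat.lt_or_ge (D.len k) (j + D.ls + D.N) with h2 | h2
  · have hc := h.insert_right
    rw [rightCheck, allBelow_iff] at hc
    refine weaken (y := min (D.len k - j) D.N) (by omega) (insertCheck_periodicOn hb hb'
      (hc (D.len k - j) (by omega)) (by omega) (by omega) (fun o ho => ?_) c)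
    rw [← h.word_right k]
    congr 1
    omega
  -- At least N letters of the morphic part lie on each side of the insertion point.
  · obtain ⟨x, y, s, hs, heq⟩ := h.exists_pair D.K (D.Q * (4 ^ k * D.X) + (j - D.N - D.lp))
      (2 * D.N) h.N_le
    have hc := h.inner
    rw [forPairs_iff] at hc
    have hc := hc x y
    rw [innerCheck, allBelow_iff] at hc
    refine weaken (by omega) (insertCheck_periodicOn hb hb' (hc s (by omega)) (by omega) (by omega)
      (fun o ho => ?_) c)
    rw [Nat.add_sub_cancel, ← heq o (by omega), word, if_neg (by omega), if_pos (by omega)]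
    congr 1
    omega

end Scheme

/-! ### Translation to lists and exponents -/

open BetaWords

/-- The list of the first `n` letters of `W`. -/
def toList (W : ℕ → Bool) (n : ℕ) : List (Fin 2) :=
  (List.range n).map fun i => if W i then 1 else 0

@[simp] theorem length_toList (W : ℕ → Bool) (n : ℕ) : (toList W n).length = n := by
  simp [toList]

theorem getElem?_toList (W : ℕ → Bool) {n i : ℕ} (hi : i < n) :
    (toList W n)[i]? = some (if W i then 1 else 0) := by
  simp [toList, hi]

theorem letter_inj {x y : Bool} (h : (if x then 1 else 0 : Fin 2) = if y then 1 else 0) : x = y := by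
  revert h
  cases x <;> cases y <;> simp

theorem infix_iff_exists_getElem? {A : Type*} {u w : List A} :
    u <:+: w ↔ ∃ i, i + u.length ≤ w.length ∧ ∀ o < u.length, u[o]? = w[i + o]? := by
  constructor
  · rintro ⟨s, t, rfl⟩
    refine ⟨s.length, by simp, fun o ho => ?_⟩
    rw [List.append_assoc, List.getElem?_append_right (by omega), List.getElem?_append_left (by omega),
      Nat.add_sub_cancel_left]
  · rintro ⟨i, hi, h⟩
    have hu : u = (w.drop i).take u.length := by
      apply List.ext_getElem?
      intro o
      rcases Nat.lt_or_ge o u.length with ho | ho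
      · rw [List.getElem?_take_of_lt ho, List.getElem?_drop, h o ho]
      · rw [List.getElem?_eq_none ho, List.getElem?_eq_none (by simp; omega)]
    rw [hu]
    exact (List.take_prefix _ _).isInfix.trans (List.drop_suffix _ _).isInfix

theorem period_spec {A : Type*} (w : List A) : 1 ≤ period w ∧ w.HasPeriod (period w) :=
  Nat.sInf_mem (s := {p : ℕ | 1 ≤ p ∧ w.HasPeriod p})
    ⟨w.length + 1, by omega, List.hasPeriod_of_length_le _ _ (by omega)⟩

theorem isFree_toList {W : ℕ → Bool} {n a a' : ℕ} (ha' : 0 < a')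
    (h : ∀ i L p, 1 ≤ p → i + L ≤ n → a * p < a' * L → ¬ PeriodicOn W i L p) :
    IsFree (RExt.plus ((a : ℝ) / a')) (toList W n) := by
  rintro ⟨u, hu, hexp⟩
  rw [RExt.plus_le_ofReal, exponent] at hexp
  obtain ⟨hp, hper⟩ := period_spec u
  obtain ⟨i, hi, heq⟩ := infix_iff_exists_getElem?.mp hu
  rw [length_toList] at hi
  refine h i u.length (period u) hp hi ?_ fun s hs => ?_
  · rw [div_lt_div_iff₀ (by exact_mod_cast ha') (by exact_mod_cast hp), mul_comm (u.length : ℝ)] at hexp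
    exact_mod_cast hexp
  · have h1 := List.hasPeriod_iff_getElem?.mp hper s (by omega)
    rw [heq s (by omega), heq (s + period u) (by omega), getElem?_toList W (by omega),
      getElem?_toList W (by omega), Option.some_inj] at h1
    rw [Nat.add_assoc]
    exact letter_inj h1

/-- The least period of the factor may be smaller than p, which only increases the exponent. -/
theorem hasFactor_toList {W : ℕ → Bool} {n b b' i L p : ℕ} (hb' : 0 < b')
    (hp : 1 ≤ p) (hi : i + L ≤ n) (hL : b * p ≤ b' * L) (h : PeriodicOn W i L p) :
    HasFactorOfExponentGE (RExt.ofReal ((b : ℝ) / b')) (toList W n) := by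
  have hlen : (((toList W n).drop i).take L).length = L := by simp; omega
  have hget : ∀ o < L, (((toList W n).drop i).take L)[o]? =
      some (if W (i + o) then 1 else 0) := by
    intro o ho
    rw [List.getElem?_take_of_lt ho, List.getElem?_drop, getElem?_toList W (by omega)]
  refine ⟨((toList W n).drop i).take L,
    (List.take_prefix _ _).isInfix.trans (List.drop_suffix _ _).isInfix, ?_⟩
  rw [RExt.ofReal_le_ofReal, exponent, hlen]
  have hle : period (((toList W n).drop i).take L) ≤ p := by
    apply Nat.sInf_le
    refine ⟨hp, List.hasPeriod_iff_getElem?.mpr fun s hs => ?_⟩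
    rw [hlen] at hs
    rw [hget s (by omega), hget (s + p) (by omega), h s (by omega), Nat.add_assoc]
  obtain ⟨hpos, -⟩ := period_spec (((toList W n).drop i).take L)
  rw [div_le_div_iff₀ (by exact_mod_cast hb') (by exact_mod_cast hpos), mul_comm (L : ℝ)]
  exact_mod_cast (Nat.mul_le_mul_left b hle).trans hL

theorem toList_insert {W : ℕ → Bool} {n : ℕ} {w₁ w₂ : List (Fin 2)} (h : w₁ ++ w₂ = toList W n)
    (c : Bool) :
    w₁ ++ (if c then 1 else 0) :: w₂ = toList (Scheme.insert W w₁.length c) (n + 1) := by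
  have hlen : w₁.length + w₂.length = n := by
    rw [← List.length_append, h, length_toList]
  apply List.ext_getElem?
  intro i
  rcases Nat.lt_or_ge i (n + 1) with hi | hi
  · rw [getElem?_toList _ hi, Scheme.insert]
    rcases lt_trichotomy i w₁.length with h1 | rfl | h1
    · rw [if_pos h1, ← getElem?_toList W (n := n) (by omega), ← h, List.getElem?_append_left h1,
        List.getElem?_append_left h1]
    · simp
    · rw [if_neg (show ¬ i < w₁.length by omega), if_neg (show ¬ i = w₁.length by omega),
        ← getElem?_toList W (n := n) (by omega), ← h, List.getElem?_append_right (by omega),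
        List.getElem?_append_right (by omega), show i - w₁.length = (i - 1 - w₁.length) + 1 by omega,
        List.getElem?_cons_succ]
  · rw [List.getElem?_eq_none (by simp; omega), List.getElem?_eq_none (by simpa using hi)]

theorem Scheme.Valid.arbitrarilyLong {D : Scheme} (h : D.Valid) :
    ArbitrarilyLongExtremalBinary (RExt.plus ((D.a : ℝ) / D.a'))
      (RExt.ofReal ((D.b : ℝ) / D.b')) := by
  intro n
  have ha' : (0 : ℝ) < D.a' := by exact_mod_cast h.a'_pos
  have hb' : (0 : ℝ) < D.b' := by exact_mod_cast h.b'_pos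
  -- The index k = n suffices, since the length is at least 4 ^ n > n.
  refine ⟨toList (D.word n) (D.len n), ?_, ?_, ?_, isFree_toList h.a'_pos fun i L p hp hi hL =>
    h.not_periodicOn_word n hp hi hL, ?_⟩
  · rw [length_toList, len]
    have h1 : n < 4 ^ n := Nat.lt_pow_self (by norm_num)
    have h2 : 4 ^ n ≤ D.M n := Nat.le_mul_of_pos_right _ (Nat.sub_pos_of_lt h.X_lt_Y)
    have h3 : D.M n ≤ D.Q * D.M n :=
      Nat.le_mul_of_pos_left _ (Nat.mul_pos h.q_pos (by positivity))
    omega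
  · rw [RExt.lt_plus_iff, RExt.ofReal_le_ofReal, one_le_div ha']
    have := h.two_le
    exact_mod_cast (by omega : D.a' ≤ D.a)
  · rw [RExt.plus_le_ofReal, div_lt_div_iff₀ ha' hb']
    exact_mod_cast h.lt_b
  · rintro x ⟨w₁, w₂, c, hw, rfl⟩
    obtain ⟨c, rfl⟩ : ∃ d : Bool, c = if d then 1 else 0 := by
      fin_cases c
      · exact ⟨false, rfl⟩
      · exact ⟨true, rfl⟩
    have hj : w₁.length ≤ D.len n := by
      rw [← length_toList (D.word n) (D.len n), ← hw, List.length_append]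
      omega
    obtain ⟨s, L, p, hp, hs, hL, hrep⟩ := h.exists_periodicOn_insert n hj c
    rw [toList_insert hw]
    exact hasFactor_toList h.b'_pos hp hs hL hrep

/-! ### Evaluation of the finite checks for the five schemes -/

theorem scheme₁_valid : scheme₁.Valid := by
  constructor <;> decide +kernel

theorem scheme₂_valid : scheme₂.Valid := by
  constructor <;> decide +kernel

theorem scheme₃_valid : scheme₃.Valid := by
  constructor <;> decide +kernel

theorem scheme₄_valid : scheme₄.Valid := by
  constructor <;> decide +kernel

theorem scheme₅_valid : scheme₅.Valid := by
  constructor <;> decide +kernel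

end BinaryWord

theorem proposition4p2 :
    BetaWords.ArbitrarilyLongExtremalBinary
      (BetaWords.RExt.plus 2) (BetaWords.RExt.ofReal (7 / 3)) ∧
    BetaWords.ArbitrarilyLongExtremalBinary
      (BetaWords.RExt.plus (7 / 3)) (BetaWords.RExt.ofReal (17 / 7)) ∧
    BetaWords.ArbitrarilyLongExtremalBinary
      (BetaWords.RExt.plus (17 / 7)) (BetaWords.RExt.ofReal (5 / 2)) ∧
    BetaWords.ArbitrarilyLongExtremalBinary
      (BetaWords.RExt.plus (5 / 2)) (BetaWords.RExt.ofReal (18 / 7)) ∧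
    BetaWords.ArbitrarilyLongExtremalBinary
      (BetaWords.RExt.plus (18 / 7)) (BetaWords.RExt.ofReal (8 / 3)) := by
  have h₁ := BinaryWord.scheme₁_valid.arbitrarilyLong
  have h₂ := BinaryWord.scheme₂_valid.arbitrarilyLong
  have h₃ := BinaryWord.scheme₃_valid.arbitrarilyLong
  have h₄ := BinaryWord.scheme₄_valid.arbitrarilyLong
  have h₅ := BinaryWord.scheme₅_valid.arbitrarilyLong
  norm_num [BinaryWord.scheme₁] at h₁
  norm_num [BinaryWord.scheme₂] at h₂
  norm_num [BinaryWord.scheme₃] at h₃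
  norm_num [BinaryWord.scheme₄] at h₄
  norm_num [BinaryWord.scheme₅] at h₅
  exact ⟨h₁, h₂, h₃, h₄, h₅⟩
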